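/- Call a profinite group $G$ quasi-semisimple if $G$ is perfect, i.e. $G=\overline{[G,G]}$, and $G/\mathrm{Z}(G)$ is isomorphic, as a topological group, to a cartesian product $\prod_{i\in I} S_i$ of a family of non-abelian finite simple groups. Let $\Gamma$ be a finitely generated (discrete) group whose profinite completion $\widehat{\Gamma}$ is quasi-semisimple. Then every finite-dimensional complex representation $\varrho$ of $\Gamma$ has finite image and factors through the canonical homomorphism $\eta\colon\Gamma\to\widehat{\Gamma}$: there is a continuous representation $\sigma$ of $\widehat{\Gamma}$ on the same vector space with $\varrho=\sigma\circ\eta$. -/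

import Mathlib

universe u v

/-- A topological group is (topologically) perfect if its abstract commutator subgroup is dense,
that is, `G` is the closure of `[G, G]`. -/
def IsTopologicallyPerfect (G : Type u) [Group G] [TopologicalSpace G] [IsTopologicalGroup G] :
    Prop :=
  (commutator G).topologicalClosure = ⊤

/-- A profinite group `G` is quasi-semisimple if it is perfect and `G / Z(G)`, with the quotient
topology, is isomorphic as a topological group to a cartesian product of a family of non-abelian
finite simple groups, each of them carrying the discrete topology. -/
def IsQuasiSemisimple (G : ProfiniteGrp.{u}) : Prop :=
  IsTopologicallyPerfect G ∧
    ∃ (ι : Type u) (S : ι → Type u) (_ : ∀ i, Group (S i)) (_ : ∀ i, TopologicalSpace (S i)),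
      (∀ i, DiscreteTopology (S i) ∧ Finite (S i) ∧ IsSimpleGroup (S i) ∧
        ∃ a b : S i, a * b ≠ b * a) ∧
      Nonempty ((G ⧸ Subgroup.center G) ≃ₜ* (∀ i, S i))

/-- The profinite completion of `Γ`: the inverse limit of its finite quotients. -/
abbrev ProfiniteCompletionOf (Γ : Type u) [Group Γ] : ProfiniteGrp.{u} :=
  ProfiniteGrp.ProfiniteCompletion.completion (GrpCat.of Γ)

/-- The canonical homomorphism from `Γ` to its profinite completion. -/
abbrev toProfiniteCompletion (Γ : Type u) [Group Γ] : Γ →* ProfiniteCompletionOf Γ :=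
  (ProfiniteGrp.ProfiniteCompletion.eta (GrpCat.of Γ)).hom

/-- A finite-dimensional complex representation of a topological group is continuous if all its
matrix coefficients are continuous complex-valued functions on the group. -/
def IsContinuousRepresentation {G : Type u} [Group G] [TopologicalSpace G]
    {V : Type v} [AddCommGroup V] [Module ℂ V] [FiniteDimensional ℂ V]
    (σ : Representation ℂ G V) : Prop :=
  ∀ (φ : Module.Dual ℂ V) (x : V), Continuous fun g : G => φ (σ g x)

open scoped commutatorElement

/-! Since `Γ` is finitely generated, the matrix entries lie in a finitely generated subring `A` of
`ℂ`, a Noetherian domain whose residue field at a maximal ideal `m` is finite. Let `K` be the kernel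
modulo `m`. Its image in each finite quotient of `Γ` by the kernel modulo `m ^ (k + 1)` is solvable
and normal, hence central by quasi-semisimplicity (`quotient_le_center`). By Krull's intersection
theorem the image of `K` is central in the image of `Γ`, so by Schur's theorem the image of `[Γ, Γ]`
is finite. As finite quotients of `Γ` are perfect, every matrix in the image is an `m`-adic limit of
elements of that finite set, hence belongs to it. -/

/-! ### Finite residue fields of finitely generated rings. -/

instance Int.isJacobsonRing : IsJacobsonRing ℤ := by
  rw [isJacobsonRing_iff_prime_eq]
  intro P hP
  by_cases h : P = ⊥
  · subst h
    refine le_antisymm (fun x hx => ?_) Ideal.le_jacobson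
    rw [Ideal.mem_jacobson_bot] at hx
    -- The unit `x * (3 * x) + 1` is positive, so it is 1.
    rcases Int.isUnit_iff.mp (hx (3 * x)) with h | h
    · have : x * x = 0 := by linarith
      simpa using this
    · nlinarith [mul_self_nonneg x]
  · have := hP.isMaximal h
    exact Ideal.jacobson_eq_self_of_isMaximal

theorem Field.finite_of_surjective_of_finiteType_int {A K : Type*} [CommRing A] [Field K]
    [hA : Algebra.FiniteType ℤ A] (f : A →+* K) (hf : Function.Surjective f) : Finite K := by
  have : Algebra.FiniteType ℤ K := hA.of_surjective f.toIntAlgHom hf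
  have hfin : Module.Finite ℤ K := finite_of_finite_type_of_isJacobsonRing ℤ K
  obtain ⟨p, hp⟩ := CharP.exists K
  rcases Nat.eq_zero_or_pos p with rfl | hpos
  · have : CharZero K := CharP.charP_to_charZero K
    have : Algebra.IsIntegral ℤ K := Algebra.IsIntegral.of_finite ℤ K
    exact absurd (isField_of_isIntegral_of_isField
      (algebraMap ℤ K).injective_int (Field.toIsField K)) Int.not_isField
  · refine Module.finite_of_fg_torsion K ?_
    intro x
    refine ⟨⟨(p : ℤ), mem_nonZeroDivisors_of_ne_zero (by exact_mod_cast hpos.ne')⟩, ?_⟩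
    change (p : ℤ) • x = 0
    simp [zsmul_eq_mul]

theorem Ideal.finite_quotient_of_finiteType_int {A : Type*} [CommRing A] [a : Algebra ℤ A]
    [hA : Algebra.FiniteType ℤ A] (m : Ideal A) [m.IsMaximal] : Finite (A ⧸ m) := by
  let _ : Field (A ⧸ m) := Ideal.Quotient.field m
  obtain rfl : a = Ring.toIntAlgebra A := Subsingleton.elim _ _
  exact Field.finite_of_surjective_of_finiteType_int (Ideal.Quotient.mk m)
    Ideal.Quotient.mk_surjective

/-! ### Products of non-abelian simple groups. -/

theorem IsSimpleGroup.map_eq_one_of_isSolvable {S H : Type*} [Group S] [Group H] [IsSimpleGroup S]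
    (hS : ∃ a b : S, a * b ≠ b * a) (f : S →* H) [Group.IsSolvable H] (s : S) : f s = 1 := by
  rcases (inferInstance : f.ker.Normal).eq_bot_or_eq_top with h | h
  · have := Group.isSolvable_of_isSolvable_injective ((MonoidHom.ker_eq_bot_iff f).mp h)
    obtain ⟨a, b, hab⟩ := hS
    exact absurd (IsSimpleGroup.comm_iff_isSolvable.mpr this a b) hab
  · exact (h ▸ Subgroup.mem_top s : s ∈ f.ker)

theorem IsSimpleGroup.center_eq_bot {S : Type*} [Group S] [IsSimpleGroup S]
    (hS : ∃ a b : S, a * b ≠ b * a) : Subgroup.center S = ⊥ := by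
  rcases (inferInstance : (Subgroup.center S).Normal).eq_bot_or_eq_top with h | h
  · exact h
  · obtain ⟨a, b, hab⟩ := hS
    exact absurd (Subgroup.mem_center_iff.mp (h ▸ Subgroup.mem_top a) b).symm hab

/-- An element of a product lies in every closed subgroup that contains all the factors in which
the element has a nontrivial component. -/
theorem Subgroup.mem_of_isClosed_of_forall_mulSingle_mem {ι : Type*} [DecidableEq ι]
    {S : ι → Type*} [∀ i, Group (S i)] [∀ i, TopologicalSpace (S i)]
    (K : Subgroup (∀ i, S i)) (hK : IsClosed (K : Set (∀ i, S i))) (g : ∀ i, S i)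
    (hg : ∀ i, Pi.mulSingle i (g i) ∈ K) : g ∈ K := by
  have hfin (F : Finset ι) : (fun i => if i ∈ F then g i else 1) ∈ K := by
    induction F using Finset.induction_on with
    | empty => simpa only [Finset.notMem_empty, if_false] using! K.one_mem
    | insert a F ha ih =>
      convert K.mul_mem (hg a) ih using 1
      funext i
      by_cases h : i = a
      · subst h; simp [ha]
      · simp [h]
  refine hK.mem_of_tendsto (b := Filter.atTop)
    (f := fun F : Finset ι => fun i => if i ∈ F then g i else 1) ?_ (Filter.Eventually.of_forall hfin)
  rw [tendsto_pi_nhds]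
  intro i
  refine tendsto_const_nhds.congr' ?_
  filter_upwards [Filter.eventually_ge_atTop {i}] with F hF
  simp [Finset.singleton_subset_iff.mp hF]

/-- A quotient of a product of nonabelian simple groups by a closed subgroup has no nontrivial
solvable normal subgroup. -/
theorem eq_bot_of_isSolvable_of_pi_isSimpleGroup {ι : Type*} {S : ι → Type*} [∀ i, Group (S i)]
    [∀ i, TopologicalSpace (S i)] [∀ i, IsSimpleGroup (S i)]
    (hS : ∀ i, ∃ a b : S i, a * b ≠ b * a) {R : Type*} [Group R] (f : (∀ i, S i) →* R)
    (hf : Function.Surjective f) (hker : IsClosed (f.ker : Set (∀ i, S i)))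
    (M : Subgroup R) [M.Normal] [Group.IsSolvable M] : M = ⊥ := by
  classical
  rw [eq_bot_iff]
  intro r hr
  obtain ⟨g, rfl⟩ := hf r
  refine Subgroup.mem_of_isClosed_of_forall_mulSingle_mem f.ker hker g fun i => ?_
  by_cases hgi : g i = 1
  · simp [hgi]
  let N : Subgroup (S i) := (M.comap f).comap (MonoidHom.mulSingle S i)
  have hN : N = ⊤ := by
    refine (inferInstance : N.Normal).eq_bot_or_eq_top.resolve_left fun hbot => ?_
    have : g i ∉ Subgroup.center (S i) := by
      rw [IsSimpleGroup.center_eq_bot (hS i)]; exact hgi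
    rw [Subgroup.mem_center_iff] at this
    push Not at this
    obtain ⟨s, hs⟩ := this
    have hmem : ⁅s, g i⁆ ∈ N := by
      change f (Pi.mulSingle i ⁅s, g i⁆) ∈ M
      -- Commutators with an element supported at `i` see only the `i`-th component, so normality of
      -- `M` puts a nontrivial element in `N`.
      have : (Pi.mulSingle i ⁅s, g i⁆ : ∀ i, S i) = ⁅Pi.mulSingle i s, g⁆ := by
        funext j
        by_cases h : j = i
        · subst h; simp [commutatorElement_def]
        · simp [commutatorElement_def, h]
      rw [this, commutatorElement_def, map_mul, map_inv]
      exact M.mul_mem (by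
        simpa using (inferInstance : M.Normal).conj_mem _ hr (f (Pi.mulSingle i s)))
        (M.inv_mem hr)
    rw [hbot, Subgroup.mem_bot, commutatorElement_eq_one_iff_mul_comm] at hmem
    exact hs hmem
  let φ : S i →* M := (f.comp (MonoidHom.mulSingle S i)).codRestrict M
    fun s => (hN ▸ Subgroup.mem_top s : s ∈ N)
  exact congrArg Subtype.val (IsSimpleGroup.map_eq_one_of_isSolvable (hS i) φ (g i))

/-! ### Finite quotients of quasi-semisimple groups. -/

section FiniteQuotients

variable {G : ProfiniteGrp.{u}} {Q : Type*} [Group Q] [TopologicalSpace Q] [DiscreteTopology Q]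

theorem IsTopologicallyPerfect.commutator_eq_top (hG : IsTopologicallyPerfect G) (f : G →* Q)
    (hf : Continuous f) (hsurj : Function.Surjective f) : commutator Q = ⊤ := by
  rw [eq_top_iff]
  intro q _
  obtain ⟨g, rfl⟩ := hsurj q
  have hle : (commutator G).topologicalClosure ≤ (commutator Q).comap f := by
    refine Subgroup.topologicalClosure_minimal _ ?_ ?_
    · rw [← Subgroup.map_le_iff_le_comap, map_commutator_eq]
      exact Subgroup.commutator_mono le_top le_top
    · exact (isClosed_discrete (commutator Q : Set Q)).preimage hf
  rw [hG] at hle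
  exact hle (Subgroup.mem_top g)

/-- A surjection sends center into center, so `Q ⧸ Z(Q)` is a continuous quotient of the product of
simple groups. -/
theorem IsQuasiSemisimple.le_center_of_isSolvable (hG : IsQuasiSemisimple G) (f : G →* Q)
    (hf : Continuous f) (hsurj : Function.Surjective f) (M : Subgroup Q) [M.Normal]
    [Group.IsSolvable M] : M ≤ Subgroup.center Q := by
  obtain ⟨-, ι, S, _, _, hS, ⟨e⟩⟩ := hG
  have (i : ι) : IsSimpleGroup (S i) := (hS i).2.2.1
  let π : Q →* Q ⧸ Subgroup.center Q := QuotientGroup.mk' _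
  have hcenter : Subgroup.center G ≤ (π.comp f).ker := by
    intro z hz
    rw [MonoidHom.mem_ker, MonoidHom.comp_apply, QuotientGroup.mk'_apply,
      QuotientGroup.eq_one_iff, Subgroup.mem_center_iff]
    intro q
    obtain ⟨g, rfl⟩ := hsurj q
    rw [← map_mul, ← map_mul, Subgroup.mem_center_iff.mp hz g]
  let φ : (∀ i, S i) →* Q ⧸ Subgroup.center Q :=
    (QuotientGroup.lift (Subgroup.center G) (π.comp f) hcenter).comp
      (e.symm : (∀ i, S i) ≃* _).toMonoidHom
  have hφ : Function.Surjective φ :=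
    (QuotientGroup.lift_surjective_of_surjective _ (π.comp f)
      ((QuotientGroup.mk'_surjective _).comp hsurj) hcenter).comp e.symm.surjective
  have hker : IsClosed (φ.ker : Set (∀ i, S i)) := by
    let _ : TopologicalSpace (Q ⧸ Subgroup.center Q) := ⊥
    have : DiscreteTopology (Q ⧸ Subgroup.center Q) := ⟨rfl⟩
    have hcont : Continuous φ := by
      refine Continuous.comp (g := QuotientGroup.lift (Subgroup.center G) (π.comp f) hcenter)
        ?_ e.symm.continuous
      exact Continuous.quotient_lift ((continuous_of_discreteTopology (f := π)).comp hf) _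
    exact (isClosed_discrete ({1} : Set (Q ⧸ Subgroup.center Q))).preimage hcont
  have : (M.map π).Normal := Subgroup.Normal.map inferInstance π (QuotientGroup.mk'_surjective _)
  have : Group.IsSolvable (M.map π) :=
    Group.isSolvable_of_surjective (π.subgroupMap_surjective M)
  have hbot : M.map π = ⊥ :=
    eq_bot_of_isSolvable_of_pi_isSimpleGroup (fun i => (hS i).2.2.2) φ hφ hker (M.map π)
  intro q hq
  rw [← QuotientGroup.eq_one_iff (N := Subgroup.center Q), ← Subgroup.mem_bot, ← hbot]
  exact Subgroup.mem_map_of_mem π hq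

end FiniteQuotients

/-! ### Transfer between `Γ` and its completion. -/

section Completion

variable {Γ : Type u} [Group Γ]

/-- The projection of the profinite completion onto a finite quotient. -/
def ProfiniteCompletionOf.proj (N : FiniteIndexNormalSubgroup Γ) :
    ProfiniteCompletionOf Γ →* Γ ⧸ N.toSubgroup where
  toFun x := x.1 N
  map_one' := rfl
  map_mul' _ _ := rfl

theorem ProfiniteCompletionOf.proj_toProfiniteCompletion (N : FiniteIndexNormalSubgroup Γ) (γ : Γ) :
    proj N (toProfiniteCompletion Γ γ) = (γ : Γ ⧸ N.toSubgroup) := rfl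

theorem ProfiniteCompletionOf.proj_surjective (N : FiniteIndexNormalSubgroup Γ) :
    Function.Surjective (proj N) := by
  intro q
  obtain ⟨γ, rfl⟩ := QuotientGroup.mk_surjective q
  exact ⟨_, proj_toProfiniteCompletion N γ⟩

theorem ProfiniteCompletionOf.continuous_proj (N : FiniteIndexNormalSubgroup Γ)
    [t : TopologicalSpace (Γ ⧸ N.toSubgroup)] [d : DiscreteTopology (Γ ⧸ N.toSubgroup)] :
    Continuous (proj N) := by
  obtain rfl := d.eq_bot
  exact (continuous_apply N).comp continuous_subtype_val

theorem IsQuasiSemisimple.commutator_quotient_eq_top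
    (hΓ : IsQuasiSemisimple (ProfiniteCompletionOf Γ)) (N : Subgroup Γ) [N.Normal]
    [N.FiniteIndex] : commutator (Γ ⧸ N) = ⊤ := by
  let N' := FiniteIndexNormalSubgroup.ofSubgroup N
  let f : ProfiniteCompletionOf Γ →* Γ ⧸ N := ProfiniteCompletionOf.proj N'
  let t : TopologicalSpace (Γ ⧸ N) := ⊥
  have d : DiscreteTopology (Γ ⧸ N) := ⟨rfl⟩
  have hf : Continuous f := ProfiniteCompletionOf.continuous_proj (t := t) (d := d) N'
  exact hΓ.1.commutator_eq_top f hf (ProfiniteCompletionOf.proj_surjective N')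

theorem IsQuasiSemisimple.quotient_le_center
    (hΓ : IsQuasiSemisimple (ProfiniteCompletionOf Γ)) (N : Subgroup Γ) [N.Normal]
    [N.FiniteIndex] (M : Subgroup (Γ ⧸ N)) [M.Normal] [Group.IsSolvable M] :
    M ≤ Subgroup.center (Γ ⧸ N) := by
  let N' := FiniteIndexNormalSubgroup.ofSubgroup N
  let f : ProfiniteCompletionOf Γ →* Γ ⧸ N := ProfiniteCompletionOf.proj N'
  let t : TopologicalSpace (Γ ⧸ N) := ⊥
  have d : DiscreteTopology (Γ ⧸ N) := ⟨rfl⟩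
  have hf : Continuous f := ProfiniteCompletionOf.continuous_proj (t := t) (d := d) N'
  exact hΓ.le_center_of_isSolvable f hf (ProfiniteCompletionOf.proj_surjective N') M

/-- A representation with finite image extends to a continuous representation of the profinite
completion. -/
theorem Representation.exists_continuous_extension {V : Type v} [AddCommGroup V] [Module ℂ V]
    [FiniteDimensional ℂ V] (ρ : Representation ℂ Γ V) (hρ : (Set.range ρ).Finite) :
    ∃ σ : Representation ℂ (ProfiniteCompletionOf Γ) V,
      IsContinuousRepresentation σ ∧ ∀ γ : Γ, σ (toProfiniteCompletion Γ γ) = ρ γ := by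
  have hfin : Finite ρ.toHomUnits.range := by
    refine (Set.Finite.of_finite_image (f := Units.val) (hρ.subset ?_)
      Units.val_injective.injOn).to_subtype
    rintro _ ⟨_, ⟨γ, rfl⟩, rfl⟩
    exact ⟨γ, rfl⟩
  have : ρ.toHomUnits.ker.FiniteIndex := Subgroup.finiteIndex_ker _
  let N := FiniteIndexNormalSubgroup.ofSubgroup ρ.toHomUnits.ker
  let τ : Γ ⧸ N.toSubgroup →* (V →ₗ[ℂ] V)ˣ :=
    QuotientGroup.lift ρ.toHomUnits.ker ρ.toHomUnits le_rfl
  refine ⟨(Units.coeHom _).comp (τ.comp (ProfiniteCompletionOf.proj N)), fun φ x => ?_,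
    fun γ => rfl⟩
  let _ : TopologicalSpace (Γ ⧸ N.toSubgroup) := ⊥
  have : DiscreteTopology (Γ ⧸ N.toSubgroup) := ⟨rfl⟩
  exact (continuous_of_discreteTopology
    (f := fun q : Γ ⧸ N.toSubgroup => φ ((τ q : V →ₗ[ℂ] V) x))).comp
    (ProfiniteCompletionOf.continuous_proj N)

end Completion

/-! ### Schur's theorem on groups with center of finite index. -/

section Schur

variable {G : Type*} [Group G]

/-- A commutator depends only on the cosets of its entries modulo the center. -/
theorem finite_commutatorSet_of_finiteIndex_center [(Subgroup.center G).FiniteIndex] :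
    Finite (commutatorSet G) := by
  refine ((Set.finite_range fun p : (G ⧸ Subgroup.center G) × (G ⧸ Subgroup.center G) =>
    ⁅p.1.out, p.2.out⁆).subset ?_).to_subtype
  rintro _ ⟨a, b, rfl⟩
  refine ⟨(a, b), ?_⟩
  obtain ⟨⟨y, hy⟩, hy'⟩ := QuotientGroup.mk_out_eq_mul (Subgroup.center G) a
  obtain ⟨⟨z, hz⟩, hz'⟩ := QuotientGroup.mk_out_eq_mul (Subgroup.center G) b
  have hy1 (g : G) : g * y = y * g := Subgroup.mem_center_iff.mp hy g
  have hz1 (g : G) : g * z = z * g := Subgroup.mem_center_iff.mp hz g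
  simp only [hy', hz', commutatorElement_def, mul_inv_rev]
  calc a * y * (b * z) * (y⁻¹ * a⁻¹) * (z⁻¹ * b⁻¹)
      = a * (y * (b * z)) * (y⁻¹ * a⁻¹) * (z⁻¹ * b⁻¹) := by group
    _ = a * b * (z * a⁻¹) * z⁻¹ * b⁻¹ := by rw [← hy1]; group
    _ = a * b * a⁻¹ * b⁻¹ := by rw [← hz1]; group

theorem finite_commutator_of_finiteIndex_center [(Subgroup.center G).FiniteIndex] :
    Finite (commutator G) := by
  have := finite_commutatorSet_of_finiteIndex_center (G := G)
  refine Nat.finite_of_card_ne_zero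
    (ne_zero_of_dvd_ne_zero (pow_ne_zero _ ?_) (Subgroup.card_commutator_dvd_index_center_pow G))
  exact Subgroup.FiniteIndex.index_ne_zero

end Schur

/-! ### Congruence kernels. -/

section Congruence

variable {Γ A n : Type*} [Group Γ] [CommRing A] [Fintype n] [DecidableEq n]

/-- The congruence kernel of a matrix representation modulo an ideal. -/
def congruenceKernel (R : Γ →* Matrix n n A) (I : Ideal A) : Subgroup Γ :=
  ((Ideal.Quotient.mk I).mapMatrix.toMonoidHom.comp R).toHomUnits.ker

instance (R : Γ →* Matrix n n A) (I : Ideal A) : (congruenceKernel R I).Normal :=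
  inferInstanceAs (MonoidHom.ker _).Normal

theorem congruenceKernel_finiteIndex (R : Γ →* Matrix n n A) (I : Ideal A) [Finite (A ⧸ I)] :
    (congruenceKernel R I).FiniteIndex :=
  inferInstanceAs (MonoidHom.ker _).FiniteIndex

theorem mem_congruenceKernel {R : Γ →* Matrix n n A} {I : Ideal A} {γ : Γ} :
    γ ∈ congruenceKernel R I ↔ R γ - 1 ∈ I.matrix n := by
  rw [congruenceKernel, MonoidHom.mem_ker, Units.ext_iff, Ideal.mem_matrix, ← Matrix.ext_iff]
  refine forall₂_congr fun i j => ?_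
  rw [← Ideal.Quotient.eq_zero_iff_mem, Matrix.sub_apply, map_sub, sub_eq_zero]
  have : (Ideal.Quotient.mk I) ((1 : Matrix n n A) i j) = (1 : Matrix n n (A ⧸ I)) i j := by
    rw [← map_one (Ideal.Quotient.mk I).mapMatrix]; rfl
  rw [this]
  rfl

theorem congruenceKernel_mono (R : Γ →* Matrix n n A) {I J : Ideal A} (h : I ≤ J) :
    congruenceKernel R I ≤ congruenceKernel R J := fun _ hγ =>
  mem_congruenceKernel.mpr (Ideal.matrix_monotone n h (mem_congruenceKernel.mp hγ))

theorem Ideal.mul_mem_matrix_mul {I J : Ideal A} {X Y : Matrix n n A} (hX : X ∈ I.matrix n)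
    (hY : Y ∈ J.matrix n) : X * Y ∈ (I * J).matrix n := fun i j => by
  rw [Matrix.mul_apply]
  exact Ideal.sum_mem _ fun k _ => Ideal.mul_mem_mul (hX i k) (hY k j)

theorem commutator_congruenceKernel_le (R : Γ →* Matrix n n A) (I J : Ideal A) :
    ⁅congruenceKernel R I, congruenceKernel R J⁆ ≤ congruenceKernel R (I * J) := by
  rw [Subgroup.commutator_le]
  intro g hg h hh
  rw [mem_congruenceKernel] at *
  have hcomm : R g * R h - R h * R g ∈ (I * J).matrix n := by
    -- The additive commutator ignores scalar shifts, and both products on the right have entries in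
    -- `I * J`.
    have : R g * R h - R h * R g = (R g - 1) * (R h - 1) - (R h - 1) * (R g - 1) := by
      noncomm_ring
    rw [this]
    exact sub_mem (Ideal.mul_mem_matrix_mul hg hh) (mul_comm I J ▸ Ideal.mul_mem_matrix_mul hh hg)
  have hinv : R (h * g) * R (g⁻¹ * h⁻¹) = 1 := by
    rw [← map_mul]; simp [mul_assoc]
  have : R ⁅g, h⁆ - 1 = (R g * R h - R h * R g) * R (g⁻¹ * h⁻¹) := by
    rw [sub_mul, ← map_mul R h g, hinv, commutatorElement_def, ← map_mul, ← map_mul]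
    simp only [mul_assoc]
  rw [this]
  have htop : R (g⁻¹ * h⁻¹) ∈ (⊤ : Ideal A).matrix n := fun _ _ => Submodule.mem_top
  simpa using Ideal.mul_mem_matrix_mul hcomm htop

theorem map_derivedSeries_congruenceKernel_le (R : Γ →* Matrix n n A) (I : Ideal A) (k : ℕ) :
    (derivedSeries (congruenceKernel R I) k).map (congruenceKernel R I).subtype ≤
      congruenceKernel R (I ^ (k + 1)) := by
  induction k with
  | zero =>
    rw [derivedSeries_zero, zero_add, pow_one, ← MonoidHom.range_eq_map, Subgroup.range_subtype]
  | succ k ih =>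
    rw [derivedSeries_succ, Subgroup.map_commutator]
    refine (Subgroup.commutator_mono ih ih).trans ((commutator_congruenceKernel_le R _ _).trans
      (congruenceKernel_mono R ?_))
    -- The exponent doubles at each stage; a linear bound is enough.
    rw [← pow_add]
    exact Ideal.pow_le_pow_right (by omega)

theorem isSolvable_map_congruenceKernel (R : Γ →* Matrix n n A) (I : Ideal A) (k : ℕ) :
    Group.IsSolvable ((congruenceKernel R I).map
      (QuotientGroup.mk' (congruenceKernel R (I ^ (k + 1))))) := by
  let π := QuotientGroup.mk' (congruenceKernel R (I ^ (k + 1)))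
  refine ⟨⟨k, ?_⟩⟩
  rw [← map_derivedSeries_eq (π.subgroupMap_surjective (congruenceKernel R I)) k, eq_bot_iff]
  rintro _ ⟨γ, hγ, rfl⟩
  refine Subtype.ext ((QuotientGroup.eq_one_iff _).mpr ?_)
  exact map_derivedSeries_congruenceKernel_le R I k ⟨γ, hγ, rfl⟩

variable [IsNoetherianRing A] [IsDomain A]

/-- A matrix lying in all the matrix ideals of powers of a proper ideal vanishes. -/
theorem Ideal.eq_zero_of_forall_mem_matrix_pow {I : Ideal A} (hI : I ≠ ⊤) {X : Matrix n n A}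
    (hX : ∀ k : ℕ, X ∈ (I ^ (k + 1)).matrix n) : X = 0 := by
  ext i j
  have : X i j ∈ ⨅ k : ℕ, I ^ k := by
    rw [Submodule.mem_iInf]
    exact fun k => Ideal.pow_le_pow_right k.le_succ (hX k i j)
  rwa [Ideal.iInf_pow_eq_bot_of_isDomain I hI] at this

end Congruence

/-! ### Finiteness of the matrix image. -/

section Image

variable {Γ : Type u} [Group Γ] {A n : Type*} [CommRing A] [Fintype n] [DecidableEq n]
  [IsNoetherianRing A] [IsDomain A]

theorem IsQuasiSemisimple.finite_image_commutator (hΓ : IsQuasiSemisimple (ProfiniteCompletionOf Γ))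
    (R : Γ →* Matrix n n A) (I : Ideal A) (hI : I ≠ ⊤) [Finite (A ⧸ I)] :
    (R '' (commutator Γ)).Finite := by
  have hfin (k : ℕ) : Finite (A ⧸ I ^ k) :=
    Ideal.finite_quotient_pow (IsNoetherian.noetherian I) k
  let f : Γ →* R.toHomUnits.range := R.toHomUnits.rangeRestrict
  have hf : Function.Surjective f := R.toHomUnits.rangeRestrict_surjective
  have hle : (congruenceKernel R I).map f ≤ Subgroup.center R.toHomUnits.range := by
    rintro _ ⟨γ, hγ, rfl⟩
    rw [Subgroup.mem_center_iff]
    intro q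
    obtain ⟨δ, rfl⟩ := hf q
    rw [← commutatorElement_eq_one_iff_mul_comm, ← map_commutatorElement]
    refine Subtype.ext (Units.ext ?_)
    change R ⁅δ, γ⁆ = 1
    rw [← sub_eq_zero]
    refine Ideal.eq_zero_of_forall_mem_matrix_pow hI fun k => ?_
    rw [← mem_congruenceKernel]
    have := congruenceKernel_finiteIndex R (I ^ (k + 1))
    have := isSolvable_map_congruenceKernel R I k
    let π := QuotientGroup.mk' (congruenceKernel R (I ^ (k + 1)))
    have : ((congruenceKernel R I).map π).Normal :=
      Subgroup.Normal.map inferInstance π (QuotientGroup.mk'_surjective _)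
    have hc := hΓ.quotient_le_center _ ((congruenceKernel R I).map π)
      (Subgroup.mem_map_of_mem π hγ)
    rw [← QuotientGroup.eq_one_iff, ← QuotientGroup.mk'_apply, map_commutatorElement,
      commutatorElement_eq_one_iff_mul_comm]
    exact Subgroup.mem_center_iff.mp hc _
  have := congruenceKernel_finiteIndex R I
  have : ((congruenceKernel R I).map f).FiniteIndex :=
    ⟨ne_zero_of_dvd_ne_zero Subgroup.FiniteIndex.index_ne_zero
      ((congruenceKernel R I).index_map_dvd hf)⟩
  have : (Subgroup.center R.toHomUnits.range).FiniteIndex := Subgroup.finiteIndex_of_le hle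
  have : Finite (commutator R.toHomUnits.range) := finite_commutator_of_finiteIndex_center
  refine (Set.finite_range fun x : commutator R.toHomUnits.range => (x.1.1 : Matrix n n A)).subset ?_
  rintro _ ⟨γ, hγ, rfl⟩
  refine ⟨⟨f γ, ?_⟩, rfl⟩
  have : (commutator Γ).map f ≤ commutator R.toHomUnits.range := by
    rw [map_commutator_eq]
    exact Subgroup.commutator_mono le_top le_top
  exact this (Subgroup.mem_map_of_mem f hγ)

theorem IsQuasiSemisimple.finite_range_matrix (hΓ : IsQuasiSemisimple (ProfiniteCompletionOf Γ))
    (R : Γ →* Matrix n n A) (I : Ideal A) (hI : I ≠ ⊤) [Finite (A ⧸ I)] :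
    (Set.range R).Finite := by
  refine (hΓ.finite_image_commutator R I hI).subset ?_
  rintro _ ⟨γ, rfl⟩
  have happrox (k : ℕ) : ∃ x ∈ R '' (commutator Γ), R γ - x ∈ (I ^ (k + 1)).matrix n := by
    have : Finite (A ⧸ I ^ (k + 1)) :=
      Ideal.finite_quotient_pow (IsNoetherian.noetherian I) (k + 1)
    have := congruenceKernel_finiteIndex R (I ^ (k + 1))
    let π := QuotientGroup.mk' (congruenceKernel R (I ^ (k + 1)))
    have hmem : π γ ∈ (commutator Γ).map π := by
      rw [commutator_def, Subgroup.map_commutator,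
        Subgroup.map_top_of_surjective π (QuotientGroup.mk'_surjective _), ← commutator_def,
        hΓ.commutator_quotient_eq_top]
      exact Subgroup.mem_top _
    obtain ⟨δ, hδ, hδγ⟩ := hmem
    refine ⟨R δ, ⟨δ, hδ, rfl⟩, ?_⟩
    have := mem_congruenceKernel.mp (QuotientGroup.eq.mp hδγ)
    have h2 : R γ - R δ = R δ * (R (δ⁻¹ * γ) - 1) := by
      rw [mul_sub, ← map_mul, mul_inv_cancel_left, mul_one]
    rw [h2]
    exact Ideal.mul_mem_left _ _ this
  choose x hx hxI using happrox
  have := (hΓ.finite_image_commutator R I hI).to_subtype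
  -- By pigeonhole one `d` approximates `R γ` modulo arbitrarily high powers of `I`.
  obtain ⟨d, hd⟩ := Finite.exists_infinite_fiber fun k => (⟨x k, hx k⟩ : R '' (commutator Γ))
  rw [Set.infinite_coe_iff] at hd
  have : R γ - d.1 = 0 := by
    refine Ideal.eq_zero_of_forall_mem_matrix_pow hI fun k => ?_
    obtain ⟨l, hl, hkl⟩ := hd.exists_gt k
    have hxd : x l = d.1 := congrArg Subtype.val hl
    exact Ideal.matrix_monotone n (Ideal.pow_le_pow_right (by omega)) (hxd ▸ hxI l)
  rw [sub_eq_zero.mp this]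
  exact d.2

end Image

/-! ### Reduction to a finitely generated ring. -/

theorem exists_subalgebra_finiteType_of_fg {Γ n K : Type*} [Group Γ] [Group.FG Γ] [Fintype n]
    [DecidableEq n] [CommRing K] (R : Γ →* Matrix n n K) :
    ∃ A : Subalgebra ℤ K, Algebra.FiniteType ℤ A ∧ ∀ γ i j, R γ i j ∈ A := by
  -- Monoid generators already include what inverses require, so only products of matrices occur.
  obtain ⟨s, hs⟩ := (Group.fg_iff_monoid_fg.mp ‹Group.FG Γ›).fg_top
  let t : Set K := ⋃ γ ∈ s, ⋃ i, ⋃ j, {R γ i j}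
  have ht : t.Finite := s.finite_toSet.biUnion fun γ _ => Set.finite_iUnion fun i =>
    Set.finite_iUnion fun j => Set.finite_singleton _
  refine ⟨Algebra.adjoin ℤ t, ?_, ?_⟩
  · rw [← Subalgebra.fg_iff_finiteType]
    exact ⟨ht.toFinset, by simp⟩
  · have hle : Submonoid.closure (s : Set Γ) ≤
        (Algebra.adjoin ℤ t).matrix.toSubmonoid.comap R := by
      rw [Submonoid.closure_le]
      intro γ hγ i j
      refine Algebra.subset_adjoin ?_
      simp only [t, Set.mem_iUnion, Set.mem_singleton_iff]
      exact ⟨γ, hγ, i, j, rfl⟩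
    rw [hs] at hle
    exact fun γ => hle (Submonoid.mem_top γ)

theorem IsQuasiSemisimple.finite_range_matrix_of_field {Γ : Type u} [Group Γ] [Group.FG Γ]
    (hΓ : IsQuasiSemisimple (ProfiniteCompletionOf Γ)) {K n : Type*} [Field K] [Fintype n]
    [DecidableEq n] (R : Γ →* Matrix n n K) : (Set.range R).Finite := by
  obtain ⟨A, hA, hRA⟩ := exists_subalgebra_finiteType_of_fg R
  have hnoeth : IsNoetherianRing A := Algebra.FiniteType.isNoetherianRing ℤ A
  obtain ⟨m, hm⟩ := Ideal.exists_maximal A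
  have : Finite (A ⧸ m) := Ideal.finite_quotient_of_finiteType_int m
  let ι : Matrix n n A →* Matrix n n K := A.val.mapMatrix.toRingHom.toMonoidHom
  have hι : Function.Injective ι := fun X Y h => by
    ext i j
    exact congrFun (congrFun h i) j
  let R' : Γ →* Matrix n n A :=
    { toFun γ := Matrix.of fun i j => ⟨R γ i j, hRA γ i j⟩
      map_one' := hι ((map_one R).trans (map_one ι).symm)
      map_mul' γ δ := hι ((map_mul R γ δ).trans (map_mul ι (.of fun i j => ⟨R γ i j, hRA γ i j⟩)
        (.of fun i j => ⟨R δ i j, hRA δ i j⟩)).symm) }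
  refine ((hΓ.finite_range_matrix R' m hm.ne_top).image ι).subset ?_
  rintro _ ⟨γ, rfl⟩
  exact ⟨R' γ, ⟨γ, rfl⟩, rfl⟩

theorem mainTheorem8 (Γ : Type u) [Group Γ] [Group.FG Γ]
    (hΓ : IsQuasiSemisimple (ProfiniteCompletionOf Γ))
    (V : Type v) [AddCommGroup V] [Module ℂ V] [FiniteDimensional ℂ V]
    (ρ : Representation ℂ Γ V) :
    (Set.range ρ).Finite ∧
      ∃ σ : Representation ℂ (ProfiniteCompletionOf Γ) V,
        IsContinuousRepresentation σ ∧ ∀ γ : Γ, σ (toProfiniteCompletion Γ γ) = ρ γ := by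
  have hfin : (Set.range ρ).Finite := by
    let e := LinearMap.toMatrixAlgEquiv (Module.finBasis ℂ V)
    have := hΓ.finite_range_matrix_of_field (e.toMulEquiv.toMonoidHom.comp ρ)
    refine Set.Finite.of_finite_image (f := e) (this.subset ?_) e.injective.injOn
    rintro _ ⟨_, ⟨γ, rfl⟩, rfl⟩
    exact ⟨γ, rfl⟩
  exact ⟨hfin, ρ.exists_continuous_extension hfin⟩
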